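/- Let $H$ be a complex, separable, infinite-dimensional Hilbert space and let $L(H)$ be the algebra of bounded linear operators on $H$, with identity $I$. For $T\in L(H)$ let $\mathrm{reg}(T)$ be the set of all $\lambda\in\mathbb C$ for which there are a neighborhood $U_\lambda$ of $\lambda$ and an analytic function $G:U_\lambda\to L(H)$ such that, for all $\mu\in U_\lambda$, $$(\mu I-T)G(\mu)(\mu I-T)=\mu I-T\quad\text{and}\quad G(\mu)(\mu I-T)G(\mu)=G(\mu).$$ Set $$s(T)=\sup\left\{\frac{1}{r_\sigma(S)} : S\in L(H),\ TST=T\right\},$$ where $r_\sigma(S)$ is the spectral radius of $S$ and the supremum is taken in $[0,\infty]$ with $1/0=\infty$. If $T\in L(H)$ and $0\in\mathrm{reg}(T)$, then $s(T^n)=s(T)^n$ for all $n\ge 1$. -/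

import Mathlib

noncomputable section

/-- The set `reg(T)` of all `l : ℂ` such that on some neighbourhood `U` of `l` there is an
analytic operator-valued function `G` with `G z` a generalized inverse of `z I - T`
for every `z ∈ U`. -/
def regSet {H : Type*} [NormedAddCommGroup H] [InnerProductSpace ℂ H]
    (T : H →L[ℂ] H) : Set ℂ :=
  {l : ℂ | ∃ U : Set ℂ, IsOpen U ∧ l ∈ U ∧ ∃ G : ℂ → (H →L[ℂ] H),
    AnalyticOnNhd ℂ G U ∧ ∀ z ∈ U,
      (z • (1 : H →L[ℂ] H) - T) * G z * (z • (1 : H →L[ℂ] H) - T) =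
          z • (1 : H →L[ℂ] H) - T ∧
      G z * (z • (1 : H →L[ℂ] H) - T) * G z = G z}

/-- `s(T) = sup {1 / r(S) : T S T = T}`, where `r(S)` is the spectral radius of the bounded
operator `S`; the supremum is taken in `[0, ∞]`, with `1 / 0 = ∞`. -/
def sRadius {H : Type*} [NormedAddCommGroup H] [InnerProductSpace ℂ H]
    (T : H →L[ℂ] H) : ENNReal :=
  sSup {x : ENNReal | ∃ S : H →L[ℂ] H, T * S * T = T ∧ x = 1 / spectralRadius ℂ S}

end

/-! Let M be the intersection of the ranges of the T^j. Regularity at 0 puts ker T inside M; then M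
is closed and T-invariant, T maps M onto M, and T is injective modulo M. If T S T = T, then T S = 1
on M and S T = 1 modulo M, so S^n is an inner inverse of T^n. With r(S^n) = r(S)^n this gives s(T)^n
≤ s(T^n).

Conversely, let S be an inner inverse of T^n with r(S) < r^n. By Gelfand's formula some power S^k,
an inner inverse of T^(nk), has norm at most r^(nk). Its compressions to M and Mᗮ are a right and a
left inverse of the nk-th powers of the diagonal blocks of T. A Hilbertian renorming
(`exists_left_inverse_norm_pow_le` and its adjoint) extracts one-sided inverses of the blocks
themselves whose powers are O(r^k). `exists_inner_inverse_of_compression` glues them into an inner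
inverse of T with spectral radius at most r. -/

/-! ### One-sided inverses with controlled powers, by renorming -/

open scoped InnerProductSpace in
theorem ContinuousLinearMap.exists_left_inverse_norm_pow_le {E : Type*} [NormedAddCommGroup E]
    [InnerProductSpace ℂ E] [CompleteSpace E] (A W : E →L[ℂ] E) {t : ℝ} (ht : 0 < t) {m : ℕ}
    (hm : m ≠ 0) (hW : W * A ^ m = 1) (hWt : ‖W‖ ≤ t⁻¹ ^ m) :
    ∃ (L : E →L[ℂ] E) (C : ℝ), L * A = 1 ∧ ∀ k, ‖L ^ k‖ ≤ C * t⁻¹ ^ k := by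
  have hbelow : ∀ x, ‖x‖ ≤ t⁻¹ ^ m * ‖(A ^ m) x‖ := fun x ↦ by
    calc ‖x‖ = ‖W ((A ^ m) x)‖ := by rw [← mul_apply_eq_comp, hW]; simp
      _ ≤ ‖W‖ * ‖(A ^ m) x‖ := W.le_opNorm _
      _ ≤ _ := by gcongr
  -- The square of an equivalent Hilbert norm in which A expands by t: applying A shifts the sum,
  -- trading the term ‖x‖² for the m-th term, which is no smaller by `hbelow`.
  obtain ⟨q, hq⟩ : ∃ q : E → ℝ, ∀ x, q x = ∑ k ∈ Finset.range m, (t⁻¹ ^ k * ‖(A ^ k) x‖) ^ 2 :=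
    ⟨_, fun _ ↦ rfl⟩
  obtain ⟨P, hP⟩ : ∃ P : E →L[ℂ] E,
      P = ∑ k ∈ Finset.range m, ((t⁻¹ ^ k) ^ 2 : ℂ) • (star (A ^ k) * A ^ k) := ⟨_, rfl⟩
  have hPq : ∀ x, ⟪P x, x⟫_ℂ = (q x : ℂ) := fun x ↦ by
    simp only [hP, hq, _root_.sum_apply, sum_inner, _root_.smul_apply,
      inner_smul_left, mul_apply_eq_comp, ContinuousLinearMap.star_eq_adjoint,
      ContinuousLinearMap.adjoint_inner_left, inner_self_eq_norm_sq_to_K]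
    push_cast
    refine Finset.sum_congr rfl fun k _ ↦ ?_
    simp [mul_pow]
  have hPsa : ∀ x y, ⟪P x, y⟫_ℂ = ⟪x, P y⟫_ℂ := fun x y ↦ by
    simp only [hP, _root_.sum_apply, sum_inner, inner_sum,
      _root_.smul_apply, inner_smul_left, inner_smul_right,
      mul_apply_eq_comp, ContinuousLinearMap.star_eq_adjoint,
      ContinuousLinearMap.adjoint_inner_left, ContinuousLinearMap.adjoint_inner_right]
    simp
  have hq_ge : ∀ x, ‖x‖ ^ 2 ≤ q x := fun x ↦ by
    rw [hq]
    have := Finset.single_le_sum (f := fun k ↦ (t⁻¹ ^ k * ‖(A ^ k) x‖) ^ 2)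
      (fun k _ ↦ by positivity) (Finset.mem_range.2 (Nat.pos_of_ne_zero hm))
    simpa using this
  have hq_le : ∀ x, q x ≤ ‖P‖ * ‖x‖ ^ 2 := fun x ↦ by
    have h1 : q x ≤ ‖⟪P x, x⟫_ℂ‖ := by
      rw [hPq, Complex.norm_real]; exact le_abs_self _
    refine h1.trans ((norm_inner_le_norm _ _).trans ?_)
    rw [sq, ← mul_assoc]
    gcongr
    exact P.le_opNorm x
  have hqA : ∀ x, t ^ 2 * q x ≤ q (A x) := fun x ↦ by
    have h1 : q (A x) = t ^ 2 * ∑ k ∈ Finset.range m,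
        (t⁻¹ ^ (k + 1) * ‖(A ^ (k + 1)) x‖) ^ 2 := by
      rw [hq, Finset.mul_sum]
      refine Finset.sum_congr rfl fun k _ ↦ ?_
      rw [pow_succ A, mul_apply_eq_comp, pow_succ t⁻¹]
      field_simp
    have h2 := Finset.sum_range_succ (fun k ↦ (t⁻¹ ^ k * ‖(A ^ k) x‖) ^ 2) m
    rw [Finset.sum_range_succ'] at h2
    rw [h1, hq]
    have h3 : ‖x‖ ^ 2 ≤ (t⁻¹ ^ m * ‖(A ^ m) x‖) ^ 2 := by gcongr; exact hbelow x
    simp only [pow_zero, one_mul, one_apply_eq_self] at h2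
    refine mul_le_mul_of_nonneg_left ?_ (by positivity)
    linarith
  -- B is coercive, and B⁻¹A*P is the left inverse of A that kills the P-orthogonal complement of
  -- the range of A.
  obtain ⟨B, hB⟩ : ∃ B : E →L[ℂ] E, B = star A * P * A := ⟨_, rfl⟩
  have hBu : IsUnit B := by
    refine ContinuousLinearMap.isUnit_of_forall_le_norm_inner_map B
      (c := t.toNNReal ^ 2) (pow_pos (Real.toNNReal_pos.2 ht) 2) fun x ↦ ?_
    have : ⟪B x, x⟫_ℂ = (q (A x) : ℂ) := by
      rw [← hPq, hB]
      simp [ContinuousLinearMap.star_eq_adjoint, ContinuousLinearMap.adjoint_inner_left]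
    rw [this, Complex.norm_real]
    refine le_trans ?_ (le_abs_self _)
    refine le_trans ?_ (hqA x)
    rw [mul_comm, NNReal.coe_pow, Real.coe_toNNReal _ ht.le]
    exact mul_le_mul_of_nonneg_left (hq_ge x) (by positivity)
  obtain ⟨B', hBB', hB'B⟩ := isUnit_iff_exists.1 hBu
  have hLA : (B' * star A * P) * A = 1 := by rw [← hB'B, hB]; simp only [mul_assoc]
  -- Here A z is the P-orthogonal projection of x onto the range of A, so t² q(z) ≤ q(A z) ≤ q(x).
  have hqL : ∀ x, q ((B' * star A * P) x) ≤ t⁻¹ ^ 2 * q x := fun x ↦ by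
    set z := (B' * star A * P) x with hz
    have hort : ⟪P (x - A z), A z⟫_ℂ = 0 := by
      rw [← ContinuousLinearMap.adjoint_inner_left, ← ContinuousLinearMap.star_eq_adjoint]
      have : star A * P - B * (B' * star A * P) = 0 := by
        rw [mul_assoc B', ← mul_assoc B, hBB', one_mul, sub_self]
      have h2 := congrArg (fun F : E →L[ℂ] E ↦ F x) this
      have h3 : (star A) (P (x - A z)) = 0 := by
        rw [hB] at h2
        simpa [hz, mul_assoc] using h2
      rw [h3, inner_zero_left]
    have hort' : ⟪P (A z), x - A z⟫_ℂ = 0 := by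
      rw [hPsa, ← inner_conj_symm, hort, map_zero]
    have hsum : q x = q (A z) + q (x - A z) := by
      have h1 : ⟪P x, x⟫_ℂ = ⟪P (A z), A z⟫_ℂ + ⟪P (x - A z), x - A z⟫_ℂ := by
        conv_lhs => rw [show x = A z + (x - A z) by abel]
        rw [map_add, inner_add_left, inner_add_right, inner_add_right, hort, hort', add_zero,
          zero_add]
      rw [hPq, hPq, hPq] at h1
      exact_mod_cast h1
    have h4 := hqA z
    have h5 : 0 ≤ q (x - A z) := (sq_nonneg _).trans (hq_ge _)
    rw [inv_pow, inv_mul_eq_div, le_div_iff₀ (by positivity)]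
    linarith
  refine ⟨B' * star A * P, Real.sqrt ‖P‖, hLA, fun k ↦ ?_⟩
  refine ContinuousLinearMap.opNorm_le_bound _ (by positivity) fun x ↦ ?_
  have hqk : q (((B' * star A * P) ^ k) x) ≤ (t⁻¹ ^ k) ^ 2 * q x := by
    induction k with
    | zero => simp
    | succ k ih =>
      rw [pow_succ', mul_apply_eq_comp]
      refine (hqL _).trans ?_
      calc t⁻¹ ^ 2 * q (((B' * star A * P) ^ k) x) ≤ t⁻¹ ^ 2 * ((t⁻¹ ^ k) ^ 2 * q x) := by gcongr
        _ = _ := by ring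
  refine le_of_sq_le_sq ?_ (by positivity)
  calc ‖((B' * star A * P) ^ k) x‖ ^ 2 ≤ (t⁻¹ ^ k) ^ 2 * (‖P‖ * ‖x‖ ^ 2) :=
        (hq_ge _).trans (hqk.trans (by gcongr; exact hq_le x))
    _ = _ := by rw [mul_pow, mul_pow, Real.sq_sqrt (norm_nonneg _)]; ring

theorem ContinuousLinearMap.exists_right_inverse_norm_pow_le {E : Type*} [NormedAddCommGroup E]
    [InnerProductSpace ℂ E] [CompleteSpace E] (A W : E →L[ℂ] E) {t : ℝ} (ht : 0 < t) {m : ℕ}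
    (hm : m ≠ 0) (hW : A ^ m * W = 1) (hWt : ‖W‖ ≤ t⁻¹ ^ m) :
    ∃ (R : E →L[ℂ] E) (C : ℝ), A * R = 1 ∧ ∀ k, ‖R ^ k‖ ≤ C * t⁻¹ ^ k := by
  obtain ⟨L, C, hL, hC⟩ := ContinuousLinearMap.exists_left_inverse_norm_pow_le (star A) (star W) ht
    hm (by rw [← star_pow, ← star_mul, hW, star_one]) (by rwa [norm_star])
  refine ⟨star L, C, ?_, fun k ↦ ?_⟩
  · rw [← star_star A, ← star_mul, hL, star_one]
  · rw [← star_pow, norm_star]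
    exact hC k

/-! ### Spectral radius estimates -/

theorem spectrum.norm_le_of_norm_pow_le {A : Type*} [NormedRing A] [NormedAlgebra ℂ A]
    [CompleteSpace A] [NormOneClass A] {a : A} {C r : ℝ} (hr : 0 < r)
    (h : ∀ k, k ≠ 0 → ‖a ^ k‖ ≤ C * r ^ k) {z : ℂ} (hz : z ∈ spectrum ℂ a) : ‖z‖ ≤ r := by
  by_contra! hlt
  have h1 : 1 < ‖z‖ / r := (one_lt_div hr).2 hlt
  obtain ⟨k, hk⟩ := pow_unbounded_of_one_lt (max C 1) h1
  have hk0 : k ≠ 0 := by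
    rintro rfl
    simp at hk
  have h2 := (spectrum.norm_le_norm_of_mem (spectrum.pow_mem_pow a k hz)).trans (h k hk0)
  rw [norm_pow, ← div_le_iff₀ (by positivity), ← div_pow] at h2
  exact absurd hk (not_lt.2 (h2.trans (le_max_left _ _)))

theorem spectrum.spectralRadius_pow {A : Type*} [NormedRing A] [NormedAlgebra ℂ A] (a : A)
    {n : ℕ} (hn : n ≠ 0) : spectralRadius ℂ (a ^ n) = spectralRadius ℂ a ^ n := by
  refine le_antisymm (iSup₂_le fun z hz ↦ ?_) (spectrum.spectralRadius_pow_le a n hn)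
  rw [spectrum.map_pow_of_pos a (Nat.pos_of_ne_zero hn)] at hz
  obtain ⟨w, hw, rfl⟩ := hz
  simp only [nnnorm_pow, ENNReal.coe_pow]
  gcongr
  exact le_iSup₂ (f := fun (z : ℂ) (_ : z ∈ spectrum ℂ a) ↦ (‖z‖₊ : ENNReal)) w hw

theorem exists_norm_pow_le_of_spectralRadius_lt {A : Type*} [NormedRing A] [NormedAlgebra ℂ A]
    [CompleteSpace A] {a : A} {r : NNReal} (h : spectralRadius ℂ a < r) :
    ∃ k, k ≠ 0 ∧ ‖a ^ k‖ ≤ (r : ℝ) ^ k := by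
  obtain ⟨k, hk, hk0⟩ := (((spectrum.pow_nnnorm_pow_one_div_tendsto_nhds_spectralRadius a).eventually
    (gt_mem_nhds h)).and (Filter.eventually_ne_atTop 0)).exists
  refine ⟨k, hk0, ?_⟩
  have h1 : ((‖a ^ k‖₊ : ENNReal) ^ (1 / k : ℝ)) ^ k ≤ (r : ENNReal) ^ k := by gcongr
  rw [← ENNReal.rpow_natCast, ← ENNReal.rpow_mul, one_div_mul_cancel (by exact_mod_cast hk0),
    ENNReal.rpow_one] at h1
  exact_mod_cast h1

/-- If the block-diagonal part `a` of the block triangular element `a - e * b * (1 - e)` has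
spectrum in a disc, so has the whole element. -/
theorem spectrum.norm_le_of_block_triangular {A : Type*} [Ring A] [Algebra ℂ A] {a b e : A}
    (he : IsIdempotentElem e) (hae : Commute a e) {r : ℝ}
    (h : ∀ z ∈ spectrum ℂ a, ‖z‖ ≤ r) {z : ℂ}
    (hz : z ∈ spectrum ℂ (a - e * b * (1 - e))) : ‖z‖ ≤ r := by
  by_contra! hlt
  have hu : IsUnit (algebraMap ℂ A z - a) := by
    by_contra hn
    exact absurd (h z hn) (not_le.2 hlt)
  obtain ⟨u, hu⟩ := hu
  refine hz ?_
  rw [spectrum.mem_resolventSet_iff]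
  have hc : Commute (u : A) e := by
    rw [hu]
    exact Commute.sub_left (Algebra.commutes z e) hae
  have hc' : Commute (↑u⁻¹ : A) e := hc.units_inv_left
  -- Since u⁻¹ commutes with e, the off-diagonal term times u⁻¹ stays strictly triangular and
  -- squares to zero.
  have hsq : (↑u⁻¹ * (e * b * (1 - e))) * (↑u⁻¹ * (e * b * (1 - e))) = 0 := by
    have h1 : (1 - e) * (↑u⁻¹ * e) = 0 := by
      rw [hc'.eq, ← mul_assoc, he.one_sub_mul_self, zero_mul]
    calc _ = ↑u⁻¹ * (e * b) * ((1 - e) * (↑u⁻¹ * e)) * (b * (1 - e)) := by noncomm_ring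
      _ = 0 := by rw [h1]; simp
  have hnil : IsNilpotent (-(↑u⁻¹ * (e * b * (1 - e)))) := ⟨2, by rw [neg_sq, sq, hsq]⟩
  have := u.isUnit.mul hnil.isUnit_one_sub
  convert this using 1
  rw [sub_neg_eq_add, mul_add, mul_one, u.mul_inv_cancel_left, hu]
  abel

/-! ### Analytic families of eigenvectors -/

theorem AnalyticAt.dslope_self {E : Type*} [NormedAddCommGroup E] [NormedSpace ℂ E]
    {f : ℂ → E} {z : ℂ} (hf : AnalyticAt ℂ f z) : AnalyticAt ℂ (dslope f z) z := by
  obtain ⟨p, hp⟩ := hf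
  exact ⟨_, hp.has_fpower_series_dslope_fslope⟩

/-- The value at `0` of an analytic family of vectors `f z ∈ ker (z - T)` has
preimages under all powers of `T`. -/
theorem ContinuousLinearMap.exists_pow_apply_eq_of_analyticAt {E : Type*} [NormedAddCommGroup E]
    [NormedSpace ℂ E] (T : E →L[ℂ] E) {f : ℂ → E} (hf : AnalyticAt ℂ f 0)
    (hTf : ∀ᶠ z in nhds 0, T (f z) = z • f z) (j : ℕ) : ∃ u, (T ^ j) u = f 0 := by
  -- Y k 0 is the k-th Taylor coefficient of f; comparing coefficients in T f(z) = z f(z) shows that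
  -- T sends each to its predecessor.
  obtain ⟨Y, hY0, hY⟩ : ∃ Y : ℕ → ℂ → E, Y 0 = f ∧ ∀ k, Y (k + 1) = dslope (Y k) 0 :=
    ⟨fun k ↦ Nat.rec f (fun _ g ↦ dslope g 0) k, rfl, fun _ ↦ rfl⟩
  have han : ∀ k, AnalyticAt ℂ (Y k) 0 := fun k ↦ by
    induction k with
    | zero => rwa [hY0]
    | succ k ih => rw [hY]; exact ih.dslope_self
  have hcomp : ∀ k z, T (Y (k + 1) z) = dslope (T ∘ Y k) 0 z := fun k z ↦ by
    rw [hY, T.dslope_comp _ _ _ fun _ ↦ (han k).differentiableAt]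
  have hT : ∀ k, ∀ᶠ z in nhds 0, T (Y (k + 1) z) = Y k z := fun k ↦ by
    induction k with
    | zero =>
      have h0 : (T ∘ Y 0) =ᶠ[nhds 0] fun z ↦ z • Y 0 z := by
        filter_upwards [hTf] with z hz
        simpa [hY0] using hz
      filter_upwards [h0] with z hz
      rw [hcomp]
      rcases eq_or_ne z 0 with rfl | hne
      · rw [dslope_same, h0.deriv_eq]
        have h1 := (hasDerivAt_id (0 : ℂ)).smul (han 0).differentiableAt.hasDerivAt
        refine h1.deriv.trans ?_
        simp
      · have h2 : T (Y 0 0) = 0 := by simpa using h0.self_of_nhds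
        rw [dslope_of_ne _ hne, slope_def_module, hz]
        simp [h2, hne]
    | succ k ih =>
      filter_upwards [ih] with z hz
      rw [hcomp, congrFun (hY k) z]
      rcases eq_or_ne z 0 with rfl | hne
      · rw [dslope_same, dslope_same]
        have ih' : (T ∘ Y (k + 1)) =ᶠ[nhds 0] Y k := ih
        exact ih'.deriv_eq
      · rw [dslope_of_ne _ hne, dslope_of_ne _ hne, slope_def_module, slope_def_module]
        simp [hz, ih.self_of_nhds]
  have key : ∀ k, (T ^ k) (Y k 0) = Y 0 0 := fun k ↦ by
    induction k with
    | zero => rfl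
    | succ k ih => rw [pow_succ, mul_apply_eq_comp, (hT k).self_of_nhds, ih]
  exact ⟨Y j 0, by rw [key, hY0]⟩

/-! ### Regular cores and inner inverses -/

/-- `M` is a `T`-invariant subspace containing `ker T` on which `T` is surjective. -/
structure IsRegularCore {E : Type*} [NormedAddCommGroup E] [NormedSpace ℂ E]
    (T : E →L[ℂ] E) (M : Submodule ℂ E) : Prop where
  map_mem : ∀ x ∈ M, T x ∈ M
  exists_preimage : ∀ y ∈ M, ∃ x ∈ M, T x = y
  ker_le : ∀ x, T x = 0 → x ∈ M

namespace IsRegularCore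

variable {E : Type*} [NormedAddCommGroup E] [NormedSpace ℂ E] {T S : E →L[ℂ] E}
  {M : Submodule ℂ E}

theorem mem_of_map_mem (h : IsRegularCore T M) {x : E} (hx : T x ∈ M) : x ∈ M := by
  obtain ⟨y, hy, hyx⟩ := h.exists_preimage _ hx
  have := h.ker_le (x - y) (by rw [map_sub, hyx, sub_self])
  simpa using M.add_mem this hy

theorem pow (h : IsRegularCore T M) (n : ℕ) : IsRegularCore (T ^ n) M := by
  induction n with
  | zero => exact ⟨fun x hx ↦ hx, fun y hy ↦ ⟨y, hy, rfl⟩, fun x hx ↦ by simp_all⟩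
  | succ n ih =>
    refine ⟨fun x hx ↦ ?_, fun y hy ↦ ?_, fun x hx ↦ ?_⟩
    · rw [pow_succ, mul_apply_eq_comp]
      exact ih.map_mem _ (h.map_mem _ hx)
    · obtain ⟨z, hz, rfl⟩ := ih.exists_preimage y hy
      obtain ⟨x, hx, rfl⟩ := h.exists_preimage z hz
      exact ⟨x, hx, by rw [pow_succ, mul_apply_eq_comp]⟩
    · rw [pow_succ, mul_apply_eq_comp] at hx
      exact h.mem_of_map_mem (ih.ker_le _ hx)

theorem inner_apply_sub_mem (h : IsRegularCore T M) (hS : T * S * T = T) (x : E) :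
    S (T x) - x ∈ M := by
  refine h.ker_le _ ?_
  have := congrArg (fun F : E →L[ℂ] E ↦ F x) hS
  rw [map_sub, sub_eq_zero]
  exact this

theorem apply_inner (h : IsRegularCore T M) (hS : T * S * T = T) {y : E} (hy : y ∈ M) :
    T (S y) = y := by
  obtain ⟨x, -, rfl⟩ := h.exists_preimage y hy
  exact congrArg (fun F : E →L[ℂ] E ↦ F x) hS

theorem inner_mem (h : IsRegularCore T M) (hS : T * S * T = T) {y : E} (hy : y ∈ M) :
    S y ∈ M := by
  refine h.mem_of_map_mem ?_
  rwa [h.apply_inner hS hy]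

/-- S^n T^n changes a vector only by an element of M, where T S is the identity; hence T S fixes S^n
T^n T x, and the induction closes. -/
theorem pow_inner_pow (h : IsRegularCore T M) (hS : T * S * T = T) (n : ℕ) :
    T ^ n * S ^ n * T ^ n = T ^ n := by
  induction n with
  | zero => simp
  | succ n ih =>
    ext x
    have h1 : S ^ n * T ^ n * T = T * S * (S ^ n * T ^ n * T) := by
      ext x
      have h2 := (h.pow n).inner_apply_sub_mem ih (T x)
      have h3 := h.apply_inner hS h2
      have h4 : T (S (T x)) = T x := congrArg (fun F : E →L[ℂ] E ↦ F x) hS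
      rw [map_sub, map_sub, h4, sub_left_inj] at h3
      exact h3.symm
    have : T ^ (n + 1) * S ^ (n + 1) * T ^ (n + 1) = T ^ (n + 1) := by
      calc T ^ (n + 1) * S ^ (n + 1) * T ^ (n + 1)
          = T ^ n * (T * S * (S ^ n * T ^ n * T)) := by
            rw [pow_succ T, pow_succ' S]; simp only [mul_assoc]
        _ = T ^ n * S ^ n * T ^ n * T := by rw [← h1]; simp only [mul_assoc]
        _ = T ^ (n + 1) := by rw [ih, pow_succ]
    rw [this]

end IsRegularCore

/-! ### The core of an operator regular at 0 -/

theorem exists_inner_inverse_of_zero_mem_regSet {H : Type*} [NormedAddCommGroup H]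
    [InnerProductSpace ℂ H] {T : H →L[ℂ] H} (hT : (0 : ℂ) ∈ regSet T) :
    ∃ S : H →L[ℂ] H, T * S * T = T := by
  obtain ⟨U, -, h0, G, -, hG⟩ := hT
  refine ⟨-G 0, ?_⟩
  have := (hG 0 h0).1
  simp only [zero_smul, zero_sub, neg_mul, mul_neg, neg_neg] at this ⊢
  rw [this, neg_neg]

theorem exists_pow_apply_eq_of_zero_mem_regSet {H : Type*} [NormedAddCommGroup H]
    [InnerProductSpace ℂ H] [CompleteSpace H] {T : H →L[ℂ] H} (hT : (0 : ℂ) ∈ regSet T) {x : H}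
    (hx : T x = 0) (j : ℕ) : ∃ u, (T ^ j) u = x := by
  obtain ⟨U, hU, h0, G, hGan, hG⟩ := hT
  -- This vector lies in ker(z - T) for z in U and equals x at z = 0, because T x = 0.
  have hf : AnalyticAt ℂ (fun z ↦ x - G z ((z • (1 : H →L[ℂ] H) - T) x)) 0 := by
    have h1 : AnalyticAt ℂ (fun z : ℂ ↦ (z • (1 : H →L[ℂ] H) - T) x) 0 := by
      have : (fun z : ℂ ↦ (z • (1 : H →L[ℂ] H) - T) x) = fun z ↦ z • x - T x := by
        ext z; simp
      rw [this]
      fun_prop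
    exact analyticAt_const.sub ((ContinuousLinearMap.id ℂ (H →L[ℂ] H)).analyticAt_bilinear _ |>.comp₂ (hGan 0 h0) h1)
  obtain ⟨u, hu⟩ := T.exists_pow_apply_eq_of_analyticAt hf (by
    filter_upwards [hU.mem_nhds h0] with z hz
    have h1 := congrArg (fun F : H →L[ℂ] H ↦ F x) (hG z hz).1
    have h2 : (z • (1 : H →L[ℂ] H) - T) (x - G z ((z • (1 : H →L[ℂ] H) - T) x)) = 0 := by
      rw [map_sub, sub_eq_zero]
      exact h1.symm
    rw [_root_.sub_apply, sub_eq_zero] at h2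
    exact h2.symm) j
  exact ⟨u, by simpa [hx] using hu⟩

theorem exists_isClosed_isRegularCore {H : Type*} [NormedAddCommGroup H]
    [InnerProductSpace ℂ H] [CompleteSpace H] {T : H →L[ℂ] H} (hT : (0 : ℂ) ∈ regSet T) :
    ∃ M : Submodule ℂ H, IsClosed (M : Set H) ∧ IsRegularCore T M := by
  obtain ⟨M, hM⟩ : ∃ M : Submodule ℂ H, M = ⨅ j : ℕ, ((T ^ j : H →L[ℂ] H) : H →ₗ[ℂ] H).range :=
    ⟨_, rfl⟩
  have hmem : ∀ x, x ∈ M ↔ ∀ j : ℕ, ∃ u, (T ^ j) u = x := fun x ↦ by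
    rw [hM, Submodule.mem_iInf]
    rfl
  have hker : ∀ x, T x = 0 → x ∈ M := fun x hx ↦
    (hmem x).2 fun j ↦ exists_pow_apply_eq_of_zero_mem_regSet hT hx j
  have hcore : IsRegularCore T M := by
    refine ⟨fun x hx ↦ (hmem _).2 fun j ↦ ?_, fun y hy ↦ ?_, hker⟩
    · obtain ⟨u, rfl⟩ := (hmem x).1 hx j
      exact ⟨T u, by rw [← mul_apply_eq_comp, ← mul_apply_eq_comp, ← pow_succ, ← pow_succ']⟩
    · choose u hu using (hmem y).1 hy
      have hTu : ∀ j, T ((T ^ j) (u (j + 1))) = y := fun j ↦ by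
        rw [← mul_apply_eq_comp, ← pow_succ', hu]
      -- Any preimage of y works: it differs from T^j u_{j+1}, another preimage, by an element of
      -- ker T, hence of the range of T^j.
      refine ⟨(T ^ 0) (u 1), (hmem _).2 fun j ↦ ?_, hTu 0⟩
      obtain ⟨v, hv⟩ := (hmem _).1
        (hker ((T ^ 0) (u 1) - (T ^ j) (u (j + 1))) (by rw [map_sub, hTu 0, hTu j, sub_self])) j
      exact ⟨v + u (j + 1), by rw [map_add, hv, sub_add_cancel]⟩
  obtain ⟨S, hS⟩ := exists_inner_inverse_of_zero_mem_regSet hT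
  refine ⟨M, ?_, hcore⟩
  -- T^j S^j is a projection onto the range of T^j, so that range is a closed fixed-point set.
  have hset : (M : Set H) = ⋂ j : ℕ, {x | (T ^ j * S ^ j) x = x} := by
    ext x
    simp only [SetLike.mem_coe, hmem, Set.mem_iInter, Set.mem_ofPred_eq]
    refine forall_congr' fun j ↦ ⟨?_, fun h ↦ ⟨_, h⟩⟩
    rintro ⟨u, rfl⟩
    exact congrArg (fun F : H →L[ℂ] H ↦ F u) (hcore.pow_inner_pow hS j)
  rw [hset]
  exact isClosed_iInter fun j ↦ isClosed_eq (T ^ j * S ^ j).continuous continuous_id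

/-! ### Compressions and extensions by zero -/

namespace Submodule

variable {H : Type*} [NormedAddCommGroup H] [InnerProductSpace ℂ H]

/-- The compression of an operator to a subspace. -/
noncomputable def compression (K : Submodule ℂ H) [K.HasOrthogonalProjection] (X : H →L[ℂ] H) :
    K →L[ℂ] K :=
  K.orthogonalProjectionOnto ∘L X ∘L K.subtypeL

/-- The extension by zero on `Kᗮ` of an operator on `K`. -/
noncomputable def extendByZero (K : Submodule ℂ H) [K.HasOrthogonalProjection] (L : K →L[ℂ] K) :
    H →L[ℂ] H :=
  K.subtypeL ∘L L ∘L K.orthogonalProjectionOnto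

variable (K : Submodule ℂ H) [K.HasOrthogonalProjection]

theorem compression_apply (X : H →L[ℂ] H) (x : K) :
    K.compression X x = K.orthogonalProjectionOnto (X x) := rfl

theorem extendByZero_apply (L : K →L[ℂ] K) (x : H) :
    K.extendByZero L x = L (K.orthogonalProjectionOnto x) := rfl

theorem norm_compression_le (X : H →L[ℂ] H) : ‖K.compression X‖ ≤ ‖X‖ :=
  ContinuousLinearMap.opNorm_le_bound _ (norm_nonneg _) fun x ↦
    (K.norm_orthogonalProjectionOnto_apply_le _).trans (X.le_opNorm x)

theorem norm_extendByZero_le (L : K →L[ℂ] K) : ‖K.extendByZero L‖ ≤ ‖L‖ :=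
  ContinuousLinearMap.opNorm_le_bound _ (norm_nonneg L) fun x ↦
    (L.le_opNorm _).trans (by gcongr; exact K.norm_orthogonalProjectionOnto_apply_le x)

theorem extendByZero_mul (L L' : K →L[ℂ] K) :
    K.extendByZero L * K.extendByZero L' = K.extendByZero (L * L') := by
  ext x
  simp [extendByZero_apply]

theorem extendByZero_pow (L : K →L[ℂ] K) {k : ℕ} (hk : k ≠ 0) :
    K.extendByZero L ^ k = K.extendByZero (L ^ k) := by
  induction k with
  | zero => exact absurd rfl hk
  | succ k ih =>
    rcases eq_or_ne k 0 with rfl | h0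
    · simp
    · rw [pow_succ, ih h0, extendByZero_mul, ← pow_succ]

theorem starProjection_mul_extendByZero (L : K →L[ℂ] K) :
    K.starProjection * K.extendByZero L = K.extendByZero L := by
  ext x
  simp [extendByZero_apply, starProjection_apply]

theorem extendByZero_mul_starProjection (L : K →L[ℂ] K) :
    K.extendByZero L * K.starProjection = K.extendByZero L := by
  ext x
  rw [mul_apply_eq_comp, extendByZero_apply, extendByZero_apply, starProjection_apply,
    orthogonalProjectionOnto_mem_subspace_eq_self]

end Submodule

/-! ### Diagonal blocks and gluing -/

namespace IsRegularCore

variable {H : Type*} [NormedAddCommGroup H] [InnerProductSpace ℂ H]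
  {T S : H →L[ℂ] H} {M : Submodule ℂ H}

section

variable [M.HasOrthogonalProjection]

theorem coe_compression_pow (h : IsRegularCore T M) (k : ℕ) (x : M) :
    ((M.compression T ^ k) x : H) = (T ^ k) x := by
  induction k generalizing x with
  | zero => rfl
  | succ k ih =>
    have : (M.compression T x : H) = T x := by
      rw [M.compression_apply]
      exact Submodule.starProjection_eq_self_iff.2 (h.map_mem _ x.2)
    rw [pow_succ, pow_succ, mul_apply_eq_comp, mul_apply_eq_comp, ih, this]

theorem compression_orthogonal_pow_sub_mem (h : IsRegularCore T M) (k : ℕ) (x : Mᗮ) :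
    ((Mᗮ.compression T ^ k) x : H) - (T ^ k) x ∈ M := by
  induction k generalizing x with
  | zero => simp
  | succ k ih =>
    have h1 : (Mᗮ.compression T x : H) - T x ∈ M := by
      have : (Mᗮ.compression T x : H) = Mᗮ.starProjection (T x) := rfl
      rw [this, Submodule.starProjection_orthogonal_val, sub_sub_cancel_left]
      exact M.neg_mem (M.starProjection_apply_mem _)
    rw [pow_succ, pow_succ, mul_apply_eq_comp, mul_apply_eq_comp]
    have h2 := M.add_mem (ih (Mᗮ.compression T x)) ((h.pow k).map_mem _ h1)
    rwa [map_sub, sub_add_sub_cancel] at h2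

theorem compression_pow_mul_compression (h : IsRegularCore T M) {m : ℕ}
    (hS : T ^ m * S * T ^ m = T ^ m) : M.compression T ^ m * M.compression S = 1 := by
  ext x
  have : (M.compression S x : H) = S x := by
    rw [M.compression_apply]
    exact Submodule.starProjection_eq_self_iff.2 ((h.pow m).inner_mem hS x.2)
  rw [mul_apply_eq_comp, h.coe_compression_pow, this, (h.pow m).apply_inner hS x.2]
  rfl

/-- Compression to Mᗮ models the action on H/M: S preserves M, and S T^m x - x lies in ker T^m,
hence in M. -/
theorem compression_mul_compression_orthogonal_pow (h : IsRegularCore T M) {m : ℕ}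
    (hS : T ^ m * S * T ^ m = T ^ m) : Mᗮ.compression S * Mᗮ.compression T ^ m = 1 := by
  ext x
  have h1 := (h.pow m).inner_mem hS (h.compression_orthogonal_pow_sub_mem m x)
  have h2 := M.add_mem h1 ((h.pow m).inner_apply_sub_mem hS (x : H))
  rw [map_sub, sub_add_sub_cancel] at h2
  rw [mul_apply_eq_comp, Mᗮ.compression_apply]
  have h3 : Mᗮ.starProjection (S ((Mᗮ.compression T ^ m) x : H)) = x :=
    Submodule.eq_starProjection_of_mem_orthogonal x.2
      (Submodule.le_orthogonal_orthogonal M h2)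
  exact h3

/-- Gluing a right inverse of `T` on `M` and a left inverse of `T` modulo `M`. -/
theorem exists_inner_inverse_of_compression [CompleteSpace H] [Nontrivial H]
    (h : IsRegularCore T M) {r C C' : ℝ} (hr : 0 < r)
    {R : M →L[ℂ] M} (hR : M.compression T * R = 1) (hRk : ∀ k, ‖R ^ k‖ ≤ C * r ^ k)
    {L : Mᗮ →L[ℂ] Mᗮ} (hL : L * Mᗮ.compression T = 1) (hLk : ∀ k, ‖L ^ k‖ ≤ C' * r ^ k) :
    ∃ S' : H →L[ℂ] H, T * S' * T = T ∧ ∀ z ∈ spectrum ℂ S', ‖z‖ ≤ r := by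
  obtain ⟨e, he⟩ : ∃ e, e = M.starProjection := ⟨_, rfl⟩
  have hf : Mᗮ.starProjection = 1 - e := by
    rw [he, Submodule.starProjection_orthogonal]; rfl
  have hee : e * e = e := he ▸ M.isIdempotentElem_starProjection
  set R' := M.extendByZero R with hR'
  set L' := Mᗮ.extendByZero L with hL'
  have heR : e * R' = R' := he ▸ M.starProjection_mul_extendByZero R
  have hRe : R' * e = R' := he ▸ M.extendByZero_mul_starProjection R
  have hfL : (1 - e) * L' = L' := hf ▸ Mᗮ.starProjection_mul_extendByZero L
  have hLf : L' * (1 - e) = L' := hf ▸ Mᗮ.extendByZero_mul_starProjection L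
  have heL : e * L' = 0 := by simpa [sub_mul] using hfL
  have hLe : L' * e = 0 := by simpa [mul_sub] using hLf
  have hTR : T * R' = e := by
    ext x
    have h1 := h.coe_compression_pow 1 (R (M.orthogonalProjectionOnto x))
    rw [pow_one, pow_one, ← mul_apply_eq_comp, hR] at h1
    rw [he]
    exact h1.symm
  have hLT : L' * T = 1 - e := by
    rw [← hf]
    ext x
    have h1 : Mᗮ.orthogonalProjectionOnto (T x) =
        Mᗮ.compression T (Mᗮ.orthogonalProjectionOnto x) := by
      rw [Mᗮ.compression_apply, ← sub_eq_zero, ← map_sub, ← map_sub]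
      refine Submodule.orthogonalProjectionOnto_orthogonal_apply_eq_zero (h.map_mem _ ?_)
      have : ((Mᗮ.orthogonalProjectionOnto x : Mᗮ) : H) = x - M.starProjection x :=
        Submodule.starProjection_orthogonal_val x
      rw [this, sub_sub_cancel]
      exact M.starProjection_apply_mem x
    rw [mul_apply_eq_comp, hL', Mᗮ.extendByZero_apply, h1, ← mul_apply_eq_comp, hL]
    rfl
  have hRL : R' * L' = 0 := by rw [← hRe, mul_assoc, heL, mul_zero]
  have hLR : L' * R' = 0 := by rw [← heR, ← mul_assoc, hLe, zero_mul]
  have hcomm : Commute (R' + L') e := by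
    change (R' + L') * e = e * (R' + L')
    rw [add_mul, mul_add, heR, hRe, heL, hLe]
  -- At k = 0 the right side would be 2.
  have hpow : ∀ k, k ≠ 0 → (R' + L') ^ k = R' ^ k + L' ^ k := fun k hk ↦ by
    induction k with
    | zero => exact absurd rfl hk
    | succ k ih =>
      rcases eq_or_ne k 0 with rfl | h0
      · simp
      · obtain ⟨j, rfl⟩ := Nat.exists_eq_succ_of_ne_zero h0
        have h1 : R' ^ (j + 1) * L' = 0 := by rw [pow_succ, mul_assoc, hRL, mul_zero]
        have h2 : L' ^ (j + 1) * R' = 0 := by rw [pow_succ, mul_assoc, hLR, mul_zero]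
        rw [pow_succ, ih h0, add_mul, mul_add, mul_add, Nat.succ_eq_add_one, h1, h2, ← pow_succ,
          ← pow_succ, add_zero, zero_add]
  have hspec : ∀ z ∈ spectrum ℂ (R' + L'), ‖z‖ ≤ r := fun z hz ↦ by
    refine spectrum.norm_le_of_norm_pow_le (C := C + C') hr (fun k hk ↦ ?_) hz
    rw [hpow k hk, hR', hL', M.extendByZero_pow R hk, Mᗮ.extendByZero_pow L hk, add_mul]
    exact (norm_add_le _ _).trans (add_le_add ((M.norm_extendByZero_le _).trans (hRk k))
      ((Mᗮ.norm_extendByZero_le _).trans (hLk k)))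
  -- With S' = R' + L' alone, T S' T exceeds T by the corner e T (1 - e). Subtracting R' T L'
  -- cancels it and, being strictly triangular, preserves the spectral bound.
  refine ⟨R' + L' - e * (R' * T * L') * (1 - e), ?_, fun z hz ↦
    spectrum.norm_le_of_block_triangular hee hcomm hspec hz⟩
  have h1 : e * (R' * T * L') * (1 - e) = R' * T * L' := by
    rw [mul_assoc, mul_assoc (R' * T), hLf, ← mul_assoc, ← mul_assoc, heR]
  rw [h1]
  calc T * (R' + L' - R' * T * L') * T
      = (T * R') * T + T * (L' * T) - (T * R') * T * (L' * T) := by noncomm_ring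
    _ = T - (1 - e) * T * e := by rw [hTR, hLT]; noncomm_ring
    _ = T := by
      rw [sub_eq_self]
      ext x
      have : (1 - e) * T * e = Mᗮ.starProjection * T * M.starProjection := by rw [hf, he]
      rw [this]
      exact Submodule.starProjection_orthogonal_apply_eq_zero
        (h.map_mem _ (M.starProjection_apply_mem x))

end

theorem exists_inner_inverse_spectralRadius_le [CompleteSpace H] [Nontrivial H]
    (h : IsRegularCore T M) (hM : IsClosed (M : Set H)) {n : ℕ} (hn : n ≠ 0)
    (hS : T ^ n * S * T ^ n = T ^ n) {r : NNReal} (hr : 0 < r)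
    (hSr : spectralRadius ℂ S < ((r ^ n : NNReal) : ENNReal)) :
    ∃ S' : H →L[ℂ] H, T * S' * T = T ∧ spectralRadius ℂ S' ≤ r := by
  obtain ⟨k, hk, hSk⟩ := exists_norm_pow_le_of_spectralRadius_lt hSr
  have hr' : (0 : ℝ) < r := hr
  have : CompleteSpace M := hM.completeSpace_coe
  have hS' := (h.pow n).pow_inner_pow hS k
  rw [← pow_mul] at hS'
  rw [NNReal.coe_pow, ← pow_mul, ← inv_inv (r : ℝ)] at hSk
  have hm : n * k ≠ 0 := Nat.mul_ne_zero hn hk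
  obtain ⟨R, C, hR, hC⟩ := ContinuousLinearMap.exists_right_inverse_norm_pow_le
    (M.compression T) (M.compression (S ^ k)) (inv_pos.2 hr') hm
    (h.compression_pow_mul_compression hS') ((M.norm_compression_le _).trans hSk)
  obtain ⟨L, C', hL, hC'⟩ := ContinuousLinearMap.exists_left_inverse_norm_pow_le
    (Mᗮ.compression T) (Mᗮ.compression (S ^ k)) (inv_pos.2 hr') hm
    (h.compression_mul_compression_orthogonal_pow hS') ((Mᗮ.norm_compression_le _).trans hSk)
  rw [inv_inv] at hC hC'
  obtain ⟨S', hS1, hS2⟩ := h.exists_inner_inverse_of_compression hr' hR hC hL hC'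
  refine ⟨S', hS1, iSup₂_le fun z hz ↦ ?_⟩
  exact_mod_cast hS2 z hz

end IsRegularCore

/-! ### Comparison of the two suprema -/

theorem ENNReal.le_pow_iff_rpow_inv_le {x y : ENNReal} {n : ℕ} (hn : n ≠ 0) :
    x ≤ y ^ n ↔ x ^ (n : ℝ)⁻¹ ≤ y := by
  rw [← ENNReal.rpow_natCast, ENNReal.rpow_inv_le_iff (by positivity)]

theorem corollary2p4 {H : Type*} [NormedAddCommGroup H] [InnerProductSpace ℂ H]
    [CompleteSpace H] [TopologicalSpace.SeparableSpace H]
    (hdim : ¬ FiniteDimensional ℂ H)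
    (T : H →L[ℂ] H) (hT : (0 : ℂ) ∈ regSet T) (n : ℕ) (hn : 1 ≤ n) :
    sRadius (T ^ n) = sRadius T ^ n := by
  have hn0 : n ≠ 0 := Nat.one_le_iff_ne_zero.1 hn
  have hnpos : (0 : ℝ) < n := by positivity
  have : Nontrivial H := not_subsingleton_iff_nontrivial.1 fun _ ↦ hdim inferInstance
  obtain ⟨M, hMc, hM⟩ := exists_isClosed_isRegularCore hT
  apply le_antisymm
  · refine sSup_le ?_
    rintro _ ⟨S, hS, rfl⟩
    rw [ENNReal.le_pow_iff_rpow_inv_le hn0]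
    -- Approximating by finite t > 0 from below gives the strict inequality r(S) < (t⁻¹)^n and also
    -- covers r(S) = 0.
    refine ENNReal.le_of_forall_pos_nnreal_lt fun t ht0 ht ↦ ?_
    rw [ENNReal.lt_rpow_inv_iff hnpos, ENNReal.rpow_natCast, one_div, ENNReal.lt_inv_iff_lt_inv] at ht
    obtain ⟨S', hS1, hS2⟩ := hM.exists_inner_inverse_spectralRadius_le hMc hn0 hS
      (r := t⁻¹) (inv_pos.2 ht0) (by
        rw [ENNReal.coe_pow, ENNReal.coe_inv ht0.ne', ← ENNReal.inv_pow]
        exact ht)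
    refine le_trans ?_ (le_sSup ⟨S', hS1, rfl⟩)
    rw [ENNReal.coe_inv ht0.ne'] at hS2
    rw [one_div]
    exact ENNReal.le_inv_iff_le_inv.1 hS2
  · rw [← ENNReal.rpow_natCast, ← ENNReal.le_rpow_inv_iff hnpos]
    refine sSup_le ?_
    rintro _ ⟨S, hS, rfl⟩
    rw [ENNReal.le_rpow_inv_iff hnpos, ENNReal.rpow_natCast]
    refine le_sSup ⟨S ^ n, hM.pow_inner_pow hS n, ?_⟩
    rw [spectrum.spectralRadius_pow S hn0, one_div, one_div, ENNReal.inv_pow]
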